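/- Let $n\ge 0$ be an integer, $1<p<\infty$, and let $\mathbb D^n=\{z\in\mathbb C^n:|z_j|<1,\ j=1,\dots,n\}$ be the unit polydisk. The Hardy space $H^p(\mathbb D^n)$ is the space of holomorphic functions $f$ on $\mathbb D^n$ with $$\|f\|_{H^p(\mathbb D^n)}:=\sup_{0<r<1}\Big(\frac1{(2\pi)^n}\int_0^{2\pi}\cdots\int_0^{2\pi}|f(re^{it_1},\dots,re^{it_n})|^p\,dt_1\cdots dt_n\Big)^{1/p}<\infty .$$ Let $z_0=(z_0^{(1)},\dots,z_0^{(n)})\in\mathbb D^n$ and $w_0\in\mathbb C$. Then among all $f\in H^p(\mathbb D^n)$ with $f(z_0)=w_0$ there is exactly one of minimal norm, namely $$f_{\min}(z)=w_0\Big(\prod_{j=1}^n\frac{1-|z_0^{(j)}|^2}{1-z_j\overline{z_0^{(j)}}}\Big)^{2/p},\qquad z\in\mathbb D^n,$$ where the power denotes the holomorphic branch on $\mathbb D^n$ with value $1$ at $z=z_0$, that is, the product over $j$ of the principal $2/p$-th powers of the factors (each of which has positive real part). Moreover $$\|f_{\min}\|_{H^p(\mathbb D^n)}=|w_0|\prod_{j=1}^n\big(1-|z_0^{(j)}|^2\big)^{1/p}.$$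 -/

import Mathlib

open scoped ENNReal ComplexConjugate

noncomputable section

/-- The open unit polydisk `𝔻ⁿ` in `ℂⁿ`. -/
def polydisk (n : ℕ) : Set (Fin n → ℂ) := {z | ∀ j, ‖z j‖ < 1}

/-- The mean
`((2π)⁻ⁿ ∫₀^{2π} ⋯ ∫₀^{2π} |f (r e^{i t₁}, …, r e^{i tₙ})| ^ p dt₁ ⋯ dtₙ) ^ (1 / p)`,
as an extended nonnegative real number. -/
def torusMean {n : ℕ} (p : ℝ) (f : (Fin n → ℂ) → ℂ) (r : ℝ) : ℝ≥0∞ :=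
  (ENNReal.ofReal (1 / (2 * Real.pi) ^ n) *
    ∫⁻ t in Set.Icc (0 : Fin n → ℝ) (fun _ => 2 * Real.pi),
      ‖f (fun j => (r : ℂ) * Complex.exp ((t j : ℂ) * Complex.I))‖ₑ ^ p) ^ (1 / p)

/-- The supremum over `0 < r < 1` of the means, possibly infinite. -/
def hardyENorm {n : ℕ} (p : ℝ) (f : (Fin n → ℂ) → ℂ) : ℝ≥0∞ :=
  ⨆ r ∈ Set.Ioo (0 : ℝ) 1, torusMean p f r

/-- `f` restricted to the polydisk is an element of the Hardy space `H^p(𝔻ⁿ)`.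
The values of `f` off the polydisk are irrelevant. -/
def MemHardy {n : ℕ} (p : ℝ) (f : (Fin n → ℂ) → ℂ) : Prop :=
  DifferentiableOn ℂ f (polydisk n) ∧ hardyENorm p f < ∞

/-- The `H^p(𝔻ⁿ)` norm, meaningful when `MemHardy p f`. -/
def hardyNorm {n : ℕ} (p : ℝ) (f : (Fin n → ℂ) → ℂ) : ℝ := (hardyENorm p f).toReal

/-- `f` is an element of `H^p(𝔻ⁿ)` with `f z₀ = w₀`, of minimal norm among all such elements. -/
def IsMinNormInterpolant {n : ℕ} (p : ℝ) (z₀ : Fin n → ℂ) (w₀ : ℂ)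
    (f : (Fin n → ℂ) → ℂ) : Prop :=
  MemHardy p f ∧ f z₀ = w₀ ∧
    ∀ g : (Fin n → ℂ) → ℂ, MemHardy p g → g z₀ = w₀ → hardyNorm p f ≤ hardyNorm p g

/-- `w₀ * (∏ⱼ (1 - |z₀ⱼ|²) / (1 - zⱼ conj z₀ⱼ)) ^ (2 / p)`, where the power of the product is the
holomorphic branch on the polydisk that equals `1` at `z = z₀`. On the polydisk each factor has
positive real part, so that branch is the product of the principal powers of the factors. (The
principal power of the product itself may jump when there are at least three factors.) -/
def hardyMinInterpolant {n : ℕ} (p : ℝ) (z₀ : Fin n → ℂ) (w₀ : ℂ) (z : Fin n → ℂ) : ℂ :=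
  w₀ * ∏ j, ((1 - (‖z₀ j‖ : ℂ) ^ 2) / (1 - z j * conj (z₀ j))) ^ ((2 / p : ℝ) : ℂ)

end

open Metric MeasureTheory

/-! On the unit torus the `p`-th power of the modulus of the kernel `hardyKernel p b` is `∏ j, (1 -
‖b j‖ ^ 2)` times the Poisson kernel at `b`. Dividing by the kernel therefore turns the `H^p` norm
into a Poisson mean. Let `f z₀ ≠ 0`, take `r < 1` close to `1` and put `b = z₀ / r`. The quotient `u
x = f (r x) / (f z₀ * hardyKernel p b x)` is holomorphic past the closed polydisk and `u b = 1`, so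
its Poisson mean at `b` is `1`. Jensen's inequality bounds the mean of `‖u‖ ^ p` below by `1`; as `r
→ 1` this gives the sharp point evaluation estimate `norm_mul_prod_le_hardyNorm`. For uniqueness,
Jensen is made quantitative (`exists_bernoulli_gap_ge`): the defect in norm controls the mean of `‖u
- 1‖`, up to an arbitrary `δ > 0`. Harnack's inequality carries this to the value of `u - 1` at any
other point. These bounds survive `r → 1` (`interpolation_gap`), so no boundary values of `f` are
needed; zero defect forces `f` to be the extremal function. -/

/-! ### Cauchy's formula on the torus. -/

theorem cons_mem_ball {n : ℕ} {R : ℝ} (hR : 0 < R) {x : ℂ} {y : Fin n → ℂ} (hx : ‖x‖ < R)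
    (hy : ‖y‖ < R) : (Fin.cons x y : Fin (n + 1) → ℂ) ∈ ball 0 R := by
  rw [mem_ball_zero_iff, pi_norm_lt_iff hR]
  intro j
  refine Fin.cases ?_ (fun i => ?_) j
  · simpa using hx
  · simpa using (norm_le_pi_norm y i).trans_lt hy

theorem continuous_torusMap {n : ℕ} (c : Fin n → ℂ) (R : Fin n → ℝ) :
    Continuous (torusMap c R) := by
  unfold torusMap; fun_prop

theorem norm_torusMap_zero_one {n : ℕ} (t : Fin n → ℝ) (j : Fin n) :
    ‖torusMap 0 1 t j‖ = 1 := by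
  simp [torusMap, Complex.norm_exp_ofReal_mul_I]

theorem torusMap_zero_one_mem_ball {n : ℕ} {R : ℝ} (hR : 1 < R) (t : Fin n → ℝ) :
    torusMap 0 1 t ∈ ball (0 : Fin n → ℂ) R := by
  rw [mem_ball_zero_iff, pi_norm_lt_iff (by linarith)]
  intro j
  rwa [norm_torusMap_zero_one]

theorem torusMap_sub_ne_zero {n : ℕ} {b : Fin n → ℂ} (hb : b ∈ polydisk n) (t : Fin n → ℝ)
    (j : Fin n) : torusMap 0 1 t j - b j ≠ 0 := by
  intro h
  have h1 := norm_torusMap_zero_one t j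
  rw [sub_eq_zero.1 h] at h1
  exact (hb j).ne h1

/-- **Cauchy's integral formula** on the unit polydisk. -/
theorem torusIntegral_prod_sub_inv_mul {n : ℕ} {R : ℝ} (hR : 1 < R) {H : (Fin n → ℂ) → ℂ}
    (hH : DifferentiableOn ℂ H (ball 0 R)) {b : Fin n → ℂ} (hb : b ∈ polydisk n) :
    torusIntegral (fun z => (∏ j, (z j - b j)⁻¹) * H z) 0 1 =
      (2 * Real.pi * Complex.I) ^ n * H b := by
  induction n with
  | zero => simp [Subsingleton.elim b 0]
  | succ n ih =>
    have hR0 : 0 < R := by linarith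
    have hint : TorusIntegrable (fun z => (∏ j, (z j - b j)⁻¹) * H z) 0 1 := by
      refine ContinuousOn.integrableOn_compact isCompact_Icc (Continuous.continuousOn ?_)
      refine Continuous.mul ?_ ?_
      · refine continuous_finsetProd _ fun j _ => Continuous.inv₀ ?_ ?_
        · exact ((continuous_apply j).comp (continuous_torusMap 0 1)).sub continuous_const
        · exact fun t => torusMap_sub_ne_zero hb t j
      · exact hH.continuousOn.comp_continuous (continuous_torusMap 0 1)
          (torusMap_zero_one_mem_ball hR)
    have htail : Fin.tail b ∈ polydisk n := fun j => hb j.succ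
    have htailR : ‖Fin.tail b‖ < R :=
      (pi_norm_lt_iff hR0).2 fun j => (htail j).trans hR
    have hcons1 : DifferentiableOn ℂ (fun x : ℂ => H (Fin.cons x (Fin.tail b))) (ball 0 R) := by
      refine hH.comp (Differentiable.differentiableOn ?_) fun x hx =>
        cons_mem_ball hR0 (by simpa using hx) htailR
      rw [differentiable_pi]
      refine Fin.cases ?_ fun i => ?_
      · simp
      · simp
    have hinner : ∀ x ∈ sphere (0 : ℂ) 1,
        torusIntegral (fun y : Fin n → ℂ => (∏ j, ((Fin.cons x y : Fin (n + 1) → ℂ) j - b j)⁻¹) *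
          H (Fin.cons x y)) ((0 : Fin (n + 1) → ℂ) ∘ Fin.succ) ((1 : Fin (n + 1) → ℝ) ∘ Fin.succ) =
        (2 * Real.pi * Complex.I) ^ n * ((x - b 0)⁻¹ • H (Fin.cons x (Fin.tail b))) := by
      intro x hx
      have hx1 : ‖x‖ = 1 := by simpa using hx
      have hd : DifferentiableOn ℂ (fun y : Fin n → ℂ => H (Fin.cons x y)) (ball 0 R) := by
        refine hH.comp (Differentiable.differentiableOn ?_) fun y hy =>
          cons_mem_ball hR0 (by linarith) (by simpa using hy)
        rw [differentiable_pi]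
        refine Fin.cases ?_ fun i => ?_
        · simp
        · simp only [Fin.cons_succ]; fun_prop
      have h := ih hd htail
      have h2 := torusIntegral_const_mul (x - b 0)⁻¹
        (fun y : Fin n → ℂ => (∏ j, (y j - Fin.tail b j)⁻¹) * H (Fin.cons x y)) 0 1
      rw [h] at h2
      rw [smul_eq_mul, mul_left_comm, ← h2]
      simp only [Fin.prod_univ_succ, Fin.cons_zero, Fin.cons_succ, mul_assoc]
      rfl
    -- Split off the first circle: the induction hypothesis evaluates the inner torus integral, the
    -- one-variable Cauchy formula the outer one.
    rw [torusIntegral_succ hint]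
    have := circleIntegral.integral_congr (c := 0) (R := 1) zero_le_one hinner
    simp only [Pi.zero_apply, Pi.one_apply]
    rw [this, circleIntegral.integral_const_mul, DifferentiableOn.circleIntegral_sub_inv_smul
      (hcons1.mono (closedBall_subset_ball hR)) (by simpa using hb 0), smul_eq_mul, pow_succ,
      Fin.cons_self_tail]
    ring

theorem one_sub_ne_zero_of_norm_lt_one {w : ℂ} (hw : ‖w‖ < 1) : 1 - w ≠ 0 := by
  intro h
  rw [← sub_eq_zero.1 h, norm_one] at hw
  exact lt_irrefl _ hw

theorem differentiableOn_prod {ι E : Type*} [Fintype ι] [NormedAddCommGroup E] [NormedSpace ℂ E]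
    {s : Set E} {g : ι → E → ℂ} (hg : ∀ i, DifferentiableOn ℂ (g i) s) :
    DifferentiableOn ℂ (fun z => ∏ i, g i z) s := by
  classical
  induction (Finset.univ : Finset ι) using Finset.induction_on with
  | empty => simp
  | insert i t hi ih =>
    simp only [Finset.prod_insert hi]
    exact (hg i).mul ih

theorem differentiableOn_const_div_one_sub_mul {n : ℕ} {s : Set (Fin n → ℂ)} {j : Fin n}
    {d : ℂ} (a : ℂ) (hs : ∀ z ∈ s, ‖z j * d‖ < 1) :
    DifferentiableOn ℂ (fun z : Fin n → ℂ => a / (1 - z j * d)) s := by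
  simp only [div_eq_mul_inv]
  refine DifferentiableOn.const_mul (DifferentiableOn.inv (h := fun z : Fin n → ℂ => 1 - z j * d)
    (by fun_prop) fun z hz => ?_) a
  exact one_sub_ne_zero_of_norm_lt_one (hs z hz)

/-! ### The Poisson kernel and Poisson's formula. -/

/-- The Poisson kernel of the polydisk at the point `b`, in terms of the angles `t`. -/
noncomputable def polyPoisson {n : ℕ} (b : Fin n → ℂ) (t : Fin n → ℝ) : ℝ :=
  ∏ j, (1 - ‖b j‖ ^ 2) / ‖torusMap 0 1 t j - b j‖ ^ 2

/-- The mean of `h` over the torus with respect to the Poisson kernel at the point `b`. -/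
noncomputable def poissonMean {n : ℕ} {E : Type*} [NormedAddCommGroup E] [NormedSpace ℝ E]
    (b : Fin n → ℂ) (h : (Fin n → ℝ) → E) : E :=
  (1 / (2 * Real.pi) ^ n : ℝ) • ∫ t in Set.Icc (0 : Fin n → ℝ) (fun _ => 2 * Real.pi),
    polyPoisson b t • h t

theorem continuous_polyPoisson {n : ℕ} {b : Fin n → ℂ} (hb : b ∈ polydisk n) :
    Continuous (polyPoisson b) := by
  refine continuous_finsetProd _ fun j _ => Continuous.div continuous_const ?_ ?_
  · exact ((((continuous_apply j).comp (continuous_torusMap 0 1)).sub continuous_const).norm).pow 2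
  · exact fun t => pow_ne_zero 2 (norm_ne_zero_iff.2 (torusMap_sub_ne_zero hb t j))

/-- On the unit circle, the Poisson kernel is the product of the Cauchy kernel and a holomorphic
function. -/
theorem poisson_eq_cauchy_mul {b ζ : ℂ} (hζ : ‖ζ‖ = 1) (hb : ‖b‖ < 1) :
    (((1 - ‖b‖ ^ 2) / ‖ζ - b‖ ^ 2 : ℝ) : ℂ) =
      ζ * (ζ - b)⁻¹ * ((1 - (‖b‖ : ℂ) ^ 2) / (1 - ζ * conj b)) := by
  have h1 : ζ - b ≠ 0 := by
    intro h
    rw [sub_eq_zero.1 h] at hζ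
    exact hb.ne hζ
  have h2 : 1 - ζ * conj b ≠ 0 :=
    one_sub_ne_zero_of_norm_lt_one (by simpa [hζ] using hb)
  have h3 : ((‖ζ - b‖ ^ 2 : ℝ) : ℂ) = (ζ - b) * conj (ζ - b) := by
    rw [Complex.mul_conj, Complex.normSq_eq_norm_sq]
  have h4 : ζ * conj ζ = 1 := by
    rw [Complex.mul_conj, Complex.normSq_eq_norm_sq, hζ]; simp
  have h5 : ζ * conj (ζ - b) = 1 - ζ * conj b := by
    rw [map_sub, mul_sub, h4]
  have hζ0 : ζ ≠ 0 := by rintro rfl; simp at hζ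
  have h6 : conj (ζ - b) ≠ 0 := (map_ne_zero _).2 h1
  rw [Complex.ofReal_div, h3, ← h5]
  push_cast
  field_simp

/-- **Poisson's integral formula** for holomorphic functions on the polydisk. -/
theorem poissonMean_eq {n : ℕ} {R : ℝ} (hR : 1 < R) {H : (Fin n → ℂ) → ℂ}
    (hH : DifferentiableOn ℂ H (ball 0 R)) {b : Fin n → ℂ} (hb : b ∈ polydisk n) :
    poissonMean b (fun t => H (torusMap 0 1 t)) = H b := by
  -- The radius is shrunk to keep the poles of the factor `K` below, where `z j * conj (b j) = 1`,
  -- outside the ball. Cauchy's formula is applied to `K * H`, and `K b = 1`.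
  obtain ⟨R', hR', hRR, hbR⟩ : ∃ R' : ℝ, 1 < R' ∧ R' ≤ R ∧ ∀ j, R' * ‖b j‖ < 1 := by
    have hlim : ∀ᶠ s in nhdsWithin (1 : ℝ) (Set.Ioi 1), ∀ j, s * ‖b j‖ < 1 := by
      refine Filter.eventually_all.2 fun j => ?_
      refine Filter.Tendsto.eventually_lt_const (u := 1) (hb j) ?_
      have : Filter.Tendsto (fun s : ℝ => s * ‖b j‖) (nhds 1) (nhds (1 * ‖b j‖)) :=
        Filter.tendsto_id.mul_const _
      rw [one_mul] at this
      exact this.mono_left nhdsWithin_le_nhds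
    obtain ⟨s, hs, hs1, hs2⟩ := (hlim.and (Ioo_mem_nhdsGT hR)).exists
    exact ⟨s, hs1, hs2.le, hs⟩
  have hR0 : 0 < R' := by linarith
  set K : (Fin n → ℂ) → ℂ := fun z => ∏ j, (1 - (‖b j‖ : ℂ) ^ 2) / (1 - z j * conj (b j)) with hK
  have hKd : DifferentiableOn ℂ K (ball 0 R') := by
    refine differentiableOn_prod fun j => differentiableOn_const_div_one_sub_mul _ fun z hz => ?_
    rw [norm_mul, RCLike.norm_conj]
    have : ‖z j‖ < R' := (norm_le_pi_norm z j).trans_lt (by simpa using hz)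
    exact (mul_le_mul_of_nonneg_right this.le (norm_nonneg _)).trans_lt (hbR j)
  have hc := torusIntegral_prod_sub_inv_mul hR'
    (hKd.mul (hH.mono (ball_subset_ball hRR))) hb
  have hKb : K b = 1 := by
    refine Finset.prod_eq_one fun j _ => ?_
    rw [Complex.mul_conj, Complex.normSq_eq_norm_sq]
    push_cast
    refine div_self ?_
    have : (1 - ‖b j‖ ^ 2 : ℝ) ≠ 0 := by nlinarith [hb j, norm_nonneg (b j)]
    exact_mod_cast this
  simp only [Pi.mul_apply, hKb, one_mul] at hc
  rw [torusIntegral] at hc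
  have hcongr : ∀ t : Fin n → ℝ, (∏ i, ((1 : Fin n → ℝ) i : ℂ) * Complex.exp (t i * Complex.I) *
      Complex.I) • ((∏ j, (torusMap 0 1 t j - b j)⁻¹) * (K (torusMap 0 1 t) * H (torusMap 0 1 t)))
      = Complex.I ^ n * (polyPoisson b t • H (torusMap 0 1 t)) := by
    intro t
    have : (polyPoisson b t : ℂ) = (∏ j, torusMap 0 1 t j) *
        (∏ j, (torusMap 0 1 t j - b j)⁻¹) * K (torusMap 0 1 t) := by
      rw [polyPoisson, Complex.ofReal_prod, ← Finset.prod_mul_distrib, hK,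
        ← Finset.prod_mul_distrib]
      exact Finset.prod_congr rfl fun j _ =>
        poisson_eq_cauchy_mul (norm_torusMap_zero_one t j) (hb j)
    rw [Complex.real_smul, this, smul_eq_mul, Finset.prod_mul_distrib]
    simp only [torusMap, Pi.zero_apply, zero_add, Finset.prod_const, Finset.card_univ,
      Fintype.card_fin]
    ring
  simp only [hcongr] at hc
  rw [integral_const_mul, mul_pow, mul_right_comm, mul_comm] at hc
  have hc' := mul_right_cancel₀ (pow_ne_zero n Complex.I_ne_zero) hc
  rw [poissonMean, hc', Complex.real_smul]
  push_cast
  field_simp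

/-! ### The tangent-line defect of `‖w‖ ^ p` at `w = 1`. -/

section Convexity

/-- Bernoulli's inequality for `‖w‖`, followed by `w.re ≤ ‖w‖`. -/
theorem bernoulli_gap_nonneg {p : ℝ} (hp : 1 < p) (w : ℂ) :
    0 ≤ ‖w‖ ^ p - 1 - p * (w.re - 1) := by
  have h1 := one_add_mul_self_le_rpow_one_add (s := ‖w‖ - 1) (by linarith [norm_nonneg w]) hp.le
  have h2 := Complex.re_le_norm w
  rw [add_sub_cancel] at h1
  nlinarith

/-- Bernoulli is strict unless `‖w‖ = 1`, and on the unit circle `w.re < 1` away from `1`. -/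
theorem bernoulli_gap_pos {p : ℝ} (hp : 1 < p) {w : ℂ} (hw : w ≠ 1) :
    0 < ‖w‖ ^ p - 1 - p * (w.re - 1) := by
  have h2 := Complex.re_le_norm w
  by_cases h : ‖w‖ = 1
  · have h3 : w.re ≠ 1 := by
      intro h3
      apply hw
      have h4 : w.re = ‖w‖ := by rw [h3, h]
      have h5 := Complex.re_eq_norm.1 h4
      apply Complex.ext
      · simpa using h3
      · simpa using (Complex.nonneg_iff.1 h5).2.symm
    have h4 : w.re < 1 := lt_of_le_of_ne (h ▸ h2) h3
    rw [h, Real.one_rpow]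
    nlinarith
  · have h1 := one_add_mul_self_lt_rpow_one_add (s := ‖w‖ - 1) (by linarith [norm_nonneg w])
      (sub_ne_zero.2 h) hp
    rw [add_sub_cancel] at h1
    nlinarith

/-- The gap is convex and vanishes at `1`, so along rays from `1` it grows at least linearly beyond
the sphere of radius `δ`, where compactness gives a positive minimum `m`. The slope is `c = m / δ`.
Inside the sphere the left side is nonpositive; subtracting `δ` avoids the quadratic behaviour near
`1`. -/
theorem exists_bernoulli_gap_ge {p : ℝ} (hp : 1 < p) {δ : ℝ} (hδ : 0 < δ) :
    ∃ c > 0, ∀ w : ℂ, c * (‖w - 1‖ - δ) ≤ ‖w‖ ^ p - 1 - p * (w.re - 1) := by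
  have hcont : Continuous fun w : ℂ => ‖w‖ ^ p - 1 - p * (w.re - 1) := by
    have : Continuous fun w : ℂ => ‖w‖ ^ p :=
      continuous_norm.rpow_const fun _ => Or.inr (by linarith)
    have := Complex.continuous_re
    fun_prop
  obtain ⟨v, hv, hmin⟩ := (isCompact_sphere (1 : ℂ) δ).exists_isMinOn
    (NormedSpace.sphere_nonempty.2 hδ.le) hcont.continuousOn
  set m := ‖v‖ ^ p - 1 - p * (v.re - 1) with hm
  have hmpos : 0 < m := by
    refine bernoulli_gap_pos hp ?_
    rintro rfl
    simp [hδ.ne] at hv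
  refine ⟨m / δ, by positivity, fun w => ?_⟩
  rcases le_or_gt ‖w - 1‖ δ with h | h
  · have h1 := bernoulli_gap_nonneg hp w
    have h2 : m / δ * (‖w - 1‖ - δ) ≤ 0 :=
      mul_nonpos_of_nonneg_of_nonpos (by positivity) (by linarith)
    linarith
  · have hw0 : 0 < ‖w - 1‖ := hδ.trans h
    set s := δ / ‖w - 1‖ with hs
    have hs0 : 0 < s := by positivity
    have hs1 : s < 1 := (div_lt_one hw0).2 h
    -- The point where the segment from `1` to `w` crosses the sphere.
    set u : ℂ := 1 + s * (w - 1) with hu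
    have hus : u ∈ sphere (1 : ℂ) δ := by
      rw [mem_sphere_iff_norm, hu, add_sub_cancel_left, norm_mul, Complex.norm_real,
        Real.norm_of_nonneg hs0.le, hs, div_mul_cancel₀ _ hw0.ne']
    have h1 : m ≤ ‖u‖ ^ p - 1 - p * (u.re - 1) := hmin hus
    have h2 : ‖u‖ ≤ (1 - s) * 1 + s * ‖w‖ := by
      have : u = ((1 - s : ℝ) : ℂ) + s * w := by rw [hu]; push_cast; ring
      rw [this]
      refine (norm_add_le _ _).trans ?_
      rw [norm_mul, Complex.norm_real, Complex.norm_real, Real.norm_of_nonneg hs0.le,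
        Real.norm_of_nonneg (by linarith), mul_one]
    have h3 := (convexOn_rpow hp.le).2 (x := 1) (y := ‖w‖) (by simp) (by simp)
      (by linarith : 0 ≤ 1 - s) hs0.le (by ring)
    simp only [smul_eq_mul, Real.one_rpow] at h3
    have h4 : ‖u‖ ^ p ≤ (1 - s) * 1 + s * ‖w‖ ^ p :=
      (Real.rpow_le_rpow (norm_nonneg _) h2 (by linarith)).trans h3
    have h5 : u.re = 1 + s * (w.re - 1) := by simp [hu]
    have h6 : m ≤ s * (‖w‖ ^ p - 1 - p * (w.re - 1)) := by
      rw [h5] at h1; linarith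
    have h7 : m / s ≤ ‖w‖ ^ p - 1 - p * (w.re - 1) := by
      rw [div_le_iff₀ hs0]; linarith
    have h8 : m / s = m / δ * ‖w - 1‖ := by rw [hs]; field_simp
    have h9 : 0 < m / δ := by positivity
    nlinarith

end Convexity

/-! ### Poisson means, Harnack's inequality and quantitative Jensen. -/

section PoissonMean

variable {n : ℕ} {b : Fin n → ℂ}

theorem polyPoisson_nonneg (hb : b ∈ polydisk n) (t : Fin n → ℝ) : 0 ≤ polyPoisson b t := by
  refine Finset.prod_nonneg fun j _ => div_nonneg ?_ (by positivity)
  nlinarith [hb j, norm_nonneg (b j)]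

theorem integrableOn_polyPoisson_smul {E : Type*} [NormedAddCommGroup E] [NormedSpace ℝ E]
    (hb : b ∈ polydisk n) {h : (Fin n → ℝ) → E} (hh : Continuous h) :
    IntegrableOn (fun t => polyPoisson b t • h t)
      (Set.Icc (0 : Fin n → ℝ) fun _ => 2 * Real.pi) :=
  ((continuous_polyPoisson hb).smul hh).continuousOn.integrableOn_compact isCompact_Icc

theorem poissonMean_add {E : Type*} [NormedAddCommGroup E] [NormedSpace ℝ E]
    (hb : b ∈ polydisk n) {g h : (Fin n → ℝ) → E} (hg : Continuous g) (hh : Continuous h) :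
    poissonMean b (fun t => g t + h t) = poissonMean b g + poissonMean b h := by
  simp only [poissonMean, smul_add]
  rw [integral_add (integrableOn_polyPoisson_smul hb hg) (integrableOn_polyPoisson_smul hb hh),
    smul_add]

theorem poissonMean_const_mul (c : ℝ) (h : (Fin n → ℝ) → ℝ) :
    poissonMean b (fun t => c * h t) = c * poissonMean b h := by
  simp only [poissonMean, smul_eq_mul, mul_left_comm _ c]
  rw [integral_const_mul]
  ring

theorem poissonMean_re (hb : b ∈ polydisk n) {h : (Fin n → ℝ) → ℂ} (hh : Continuous h) :
    poissonMean b (fun t => (h t).re) = (poissonMean b h).re := by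
  have := integral_re (𝕜 := ℂ) (integrableOn_polyPoisson_smul hb hh)
  simp only [RCLike.re_to_complex, Complex.real_smul, Complex.re_ofReal_mul] at this
  simp only [poissonMean, smul_eq_mul, Complex.real_smul, Complex.re_ofReal_mul, this]

theorem poissonMean_one (hb : b ∈ polydisk n) : poissonMean b (fun _ => (1 : ℝ)) = 1 := by
  have h := poissonMean_re hb (h := fun _ => 1) continuous_const
  rw [poissonMean_eq (R := 2) (by norm_num) (H := fun _ => 1) (by fun_prop) hb] at h
  simpa using h

theorem poissonMean_mono (hb : b ∈ polydisk n) {g h : (Fin n → ℝ) → ℝ} (hg : Continuous g)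
    (hh : Continuous h) (hle : ∀ t, g t ≤ h t) : poissonMean b g ≤ poissonMean b h := by
  refine smul_le_smul_of_nonneg_left ?_ (by positivity)
  exact integral_mono (integrableOn_polyPoisson_smul hb hg) (integrableOn_polyPoisson_smul hb hh)
    fun t => mul_le_mul_of_nonneg_left (hle t) (polyPoisson_nonneg hb t)

theorem norm_poissonMean_le (hb : b ∈ polydisk n) (h : (Fin n → ℝ) → ℂ) :
    ‖poissonMean b h‖ ≤ poissonMean b (fun t => ‖h t‖) := by
  rw [poissonMean, poissonMean, norm_smul, smul_eq_mul, Real.norm_of_nonneg (by positivity)]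
  refine mul_le_mul_of_nonneg_left ((norm_integral_le_integral_norm _).trans_eq ?_) (by positivity)
  refine integral_congr_ae (Filter.Eventually.of_forall fun t => ?_)
  simp [abs_of_nonneg (polyPoisson_nonneg hb t)]

/-- The constant in Harnack's inequality on the polydisk. -/
noncomputable def harnackConst (b' b : Fin n → ℂ) : ℝ :=
  ∏ j, (1 + ‖b' j‖) / (1 - ‖b' j‖) * ((1 + ‖b j‖) / (1 - ‖b j‖))

theorem harnackConst_pos {b' : Fin n → ℂ} (hb' : b' ∈ polydisk n) (hb : b ∈ polydisk n) :
    0 < harnackConst b' b := by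
  refine Finset.prod_pos fun j _ => ?_
  have h1 : 0 < 1 - ‖b' j‖ := sub_pos.2 (hb' j)
  have h2 : 0 < 1 - ‖b j‖ := sub_pos.2 (hb j)
  positivity

/-- Each factor of the kernel at `b` is at least `(1 - ‖b j‖) / (1 + ‖b j‖)`, and each factor at
`b'` is at most the reciprocal expression in `b'`. -/
theorem polyPoisson_le_harnackConst_mul {b' : Fin n → ℂ} (hb' : b' ∈ polydisk n)
    (hb : b ∈ polydisk n) (t : Fin n → ℝ) :
    polyPoisson b' t ≤ harnackConst b' b * polyPoisson b t := by
  rw [polyPoisson, harnackConst, polyPoisson, ← Finset.prod_mul_distrib]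
  refine Finset.prod_le_prod (fun j _ => ?_) fun j _ => ?_
  · have := hb' j
    exact div_nonneg (by nlinarith [norm_nonneg (b' j)]) (by positivity)
  have h1 : 0 < 1 - ‖b' j‖ := sub_pos.2 (hb' j)
  have h2 : 0 < 1 - ‖b j‖ := sub_pos.2 (hb j)
  have hζ := norm_torusMap_zero_one t j
  have hl : 1 - ‖b' j‖ ≤ ‖torusMap 0 1 t j - b' j‖ := by
    simpa [hζ] using norm_sub_norm_le (torusMap 0 1 t j) (b' j)
  have hu : ‖torusMap 0 1 t j - b j‖ ≤ 1 + ‖b j‖ := by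
    simpa [hζ] using norm_sub_le (torusMap 0 1 t j) (b j)
  have hpos : 0 < ‖torusMap 0 1 t j - b j‖ := norm_pos_iff.2 (torusMap_sub_ne_zero hb t j)
  have e1 : (1 - ‖b' j‖ ^ 2) / ‖torusMap 0 1 t j - b' j‖ ^ 2 ≤ (1 + ‖b' j‖) / (1 - ‖b' j‖) := by
    calc _ ≤ (1 - ‖b' j‖ ^ 2) / (1 - ‖b' j‖) ^ 2 := by
          refine div_le_div_of_nonneg_left ?_ (by positivity) (by gcongr)
          nlinarith [norm_nonneg (b' j)]
      _ = _ := by field_simp; ring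
  have e2 : (1 - ‖b j‖) / (1 + ‖b j‖) ≤ (1 - ‖b j‖ ^ 2) / ‖torusMap 0 1 t j - b j‖ ^ 2 := by
    calc _ = (1 - ‖b j‖ ^ 2) / (1 + ‖b j‖) ^ 2 := by field_simp; ring
      _ ≤ _ := by
          refine div_le_div_of_nonneg_left ?_ (by positivity) (by gcongr)
          nlinarith [norm_nonneg (b j)]
  calc _ ≤ (1 + ‖b' j‖) / (1 - ‖b' j‖) := e1
    _ = (1 + ‖b' j‖) / (1 - ‖b' j‖) * ((1 + ‖b j‖) / (1 - ‖b j‖)) *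
        ((1 - ‖b j‖) / (1 + ‖b j‖)) := by field_simp
    _ ≤ _ := by gcongr

theorem poissonMean_le_harnackConst_mul {b' : Fin n → ℂ} (hb' : b' ∈ polydisk n)
    (hb : b ∈ polydisk n) {h : (Fin n → ℝ) → ℝ} (hh : Continuous h) (h0 : ∀ t, 0 ≤ h t) :
    poissonMean b' h ≤ harnackConst b' b * poissonMean b h := by
  rw [← poissonMean_const_mul]
  refine smul_le_smul_of_nonneg_left ?_ (by positivity)
  refine integral_mono (integrableOn_polyPoisson_smul hb' hh)
    (integrableOn_polyPoisson_smul hb (continuous_const.mul hh)) fun t => ?_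
  have := mul_le_mul_of_nonneg_right (polyPoisson_le_harnackConst_mul hb' hb t) (h0 t)
  simp only [smul_eq_mul]
  linarith

/-- A quantitative form of Jensen's inequality for a function of Poisson mean one. -/
theorem mul_poissonMean_norm_sub_one_le {p c δ : ℝ} (hp : 1 < p)
    (hc : ∀ w : ℂ, c * (‖w - 1‖ - δ) ≤ ‖w‖ ^ p - 1 - p * (w.re - 1)) (hb : b ∈ polydisk n)
    {u : (Fin n → ℝ) → ℂ} (hu : Continuous u) (hmean : poissonMean b u = 1) :
    c * (poissonMean b (fun t => ‖u t - 1‖) - δ) ≤ poissonMean b (fun t => ‖u t‖ ^ p) - 1 := by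
  have hre : Continuous fun t => (u t).re := Complex.continuous_re.comp hu
  have hn : Continuous fun t => ‖u t - 1‖ := (hu.sub continuous_const).norm
  have hpow : Continuous fun t => ‖u t‖ ^ p :=
    hu.norm.rpow_const fun _ => Or.inr (by linarith)
  have h := poissonMean_mono hb
    (g := fun t => c * ‖u t - 1‖ + (p * (u t).re + (1 - p - c * δ) * 1)) (h := fun t => ‖u t‖ ^ p)
    (by fun_prop) hpow (fun t => by linarith [hc (u t)])
  rw [poissonMean_add hb (by fun_prop) (by fun_prop), poissonMean_add hb (by fun_prop)
    (by fun_prop), poissonMean_const_mul, poissonMean_const_mul, poissonMean_const_mul,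
    poissonMean_one hb, poissonMean_re hb hu, hmean, Complex.one_re] at h
  linarith

end PoissonMean

/-! ### The extremal kernel. -/

section Kernel

variable {n : ℕ}

/-- The interpolant `hardyMinInterpolant` with value `1` at the point `b`. -/
noncomputable def hardyKernel (p : ℝ) (b z : Fin n → ℂ) : ℂ :=
  ∏ j, ((1 - (‖b j‖ : ℂ) ^ 2) / (1 - z j * conj (b j))) ^ ((2 / p : ℝ) : ℂ)

theorem div_one_sub_mem_slitPlane {x : ℝ} (hx : x < 1) (hx0 : 0 ≤ x) {w : ℂ} (hw : ‖w‖ < 1) :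
    (1 - (x : ℂ) ^ 2) / (1 - w) ∈ Complex.slitPlane := by
  left
  have h1 : (1 - (x : ℂ) ^ 2) = ((1 - x ^ 2 : ℝ) : ℂ) := by push_cast; ring
  have h2 : 0 < 1 - x ^ 2 := by nlinarith
  have h3 : 0 < (1 - w).re := by
    have := (Complex.re_le_norm w).trans_lt hw
    simpa using this
  have h4 : 0 < Complex.normSq (1 - w) :=
    Complex.normSq_pos.2 (one_sub_ne_zero_of_norm_lt_one hw)
  rw [h1, div_eq_mul_inv, Complex.re_ofReal_mul, Complex.inv_re]
  positivity

theorem hardyKernel_ne_zero (p : ℝ) {b z : Fin n → ℂ} (hb : b ∈ polydisk n)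
    (hz : ∀ j, ‖z j * conj (b j)‖ < 1) : hardyKernel p b z ≠ 0 := by
  refine Finset.prod_ne_zero_iff.2 fun j _ => ?_
  have := Complex.slitPlane_ne_zero (div_one_sub_mem_slitPlane (hb j) (norm_nonneg _) (hz j))
  rw [Ne, Complex.cpow_eq_zero_iff]
  exact fun h => this h.1

theorem hardyKernel_self (p : ℝ) {b : Fin n → ℂ} (hb : b ∈ polydisk n) :
    hardyKernel p b b = 1 := by
  refine Finset.prod_eq_one fun j _ => ?_
  rw [Complex.mul_conj, Complex.normSq_eq_norm_sq]
  push_cast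
  rw [div_self, Complex.one_cpow]
  have : (1 - ‖b j‖ ^ 2 : ℝ) ≠ 0 := by nlinarith [hb j, norm_nonneg (b j)]
  exact_mod_cast this

theorem differentiableOn_hardyKernel (p : ℝ) {b : Fin n → ℂ} (hb : b ∈ polydisk n)
    {s : Set (Fin n → ℂ)} (hs : ∀ z ∈ s, ∀ j, ‖z j * conj (b j)‖ < 1) :
    DifferentiableOn ℂ (hardyKernel p b) s := by
  refine differentiableOn_prod fun j => DifferentiableOn.cpow_const
    (differentiableOn_const_div_one_sub_mul _ fun z hz => hs z hz j) fun z hz => ?_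
  exact div_one_sub_mem_slitPlane (hb j) (norm_nonneg _) (hs z hz j)

theorem norm_mul_conj_lt_one {z w : ℂ} (hz : ‖z‖ ≤ 1) (hw : ‖w‖ < 1) : ‖z * conj w‖ < 1 := by
  rw [norm_mul, RCLike.norm_conj]
  exact (mul_le_of_le_one_left (norm_nonneg _) hz).trans_lt hw

/-- On the unit circle, `‖1 - ζ * conj c‖ = ‖ζ - c‖`. -/
theorem norm_one_sub_mul_conj {ζ : ℂ} (hζ : ‖ζ‖ = 1) (c : ℂ) : ‖1 - ζ * conj c‖ = ‖ζ - c‖ := by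
  have h4 : ζ * conj ζ = 1 := by
    rw [Complex.mul_conj, Complex.normSq_eq_norm_sq, hζ]; simp
  rw [← h4, ← mul_sub, ← map_sub, norm_mul, RCLike.norm_conj, hζ, one_mul]

/-- Raising to the power `p` turns the exponent `2 / p` into `2`. The radius then moves from the
variable to the base point, and `‖1 - ζ * conj c‖ = ‖ζ - c‖` with `c = r * b j` produces the Poisson
denominator. -/
theorem norm_hardyKernel_rpow {p : ℝ} (hp : 1 < p) {b : Fin n → ℂ} (hb : b ∈ polydisk n)
    {r : ℝ} (hr0 : 0 ≤ r) (hr1 : r ≤ 1) (t : Fin n → ℝ) :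
    ‖hardyKernel p b ((r : ℂ) • torusMap 0 1 t)‖ ^ p =
      (∏ j, (1 - ‖b j‖ ^ 2) ^ 2 / (1 - r ^ 2 * ‖b j‖ ^ 2)) * polyPoisson ((r : ℂ) • b) t := by
  rw [hardyKernel, norm_prod, ← Real.finsetProd_rpow _ _ fun _ _ => norm_nonneg _, polyPoisson,
    ← Finset.prod_mul_distrib]
  refine Finset.prod_congr rfl fun j _ => ?_
  have h1 : 0 < 1 - ‖b j‖ ^ 2 := by nlinarith [hb j, norm_nonneg (b j)]
  have h2 : 0 < 1 - r ^ 2 * ‖b j‖ ^ 2 := by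
    have : r ^ 2 ≤ 1 := by nlinarith
    nlinarith [sq_nonneg (‖b j‖)]
  have h3 : ‖(1 - (‖b j‖ : ℂ) ^ 2)‖ = 1 - ‖b j‖ ^ 2 := by
    rw [← Complex.ofReal_one, ← Complex.ofReal_pow, ← Complex.ofReal_sub, Complex.norm_real,
      Real.norm_of_nonneg h1.le]
  have h4 : ((r : ℂ) • torusMap 0 1 t) j * conj (b j) =
      torusMap 0 1 t j * conj (((r : ℂ) • b) j) := by
    simp only [Pi.smul_apply, smul_eq_mul, map_mul, Complex.conj_ofReal]
    ring
  rw [Complex.norm_cpow_real, ← Real.rpow_mul (norm_nonneg _), div_mul_cancel₀ _ (by linarith),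
    Real.rpow_two, norm_div, h3, h4, norm_one_sub_mul_conj (norm_torusMap_zero_one t j), div_pow]
  have h5 : 1 - ‖((r : ℂ) • b) j‖ ^ 2 = 1 - r ^ 2 * ‖b j‖ ^ 2 := by
    simp [mul_pow]
  rw [h5, div_mul_div_cancel₀ h2.ne']

end Kernel

/-! ### Hardy means as Poisson means. -/

section Mean

variable {n : ℕ}

theorem torusMean_eq {p : ℝ} (hp : 1 < p) {f : (Fin n → ℂ) → ℂ} {r C : ℝ} {b : Fin n → ℂ}
    (hb : b ∈ polydisk n) (hC : 0 ≤ C) {g : (Fin n → ℝ) → ℝ} (hg : Continuous g)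
    (hg0 : ∀ t, 0 ≤ g t)
    (hfg : ∀ t, ‖f ((r : ℂ) • torusMap 0 1 t)‖ ^ p = C * polyPoisson b t * g t) :
    torusMean p f r = ENNReal.ofReal ((C * poissonMean b g) ^ (1 / p)) := by
  have hpt : ∀ t : Fin n → ℝ, ‖f (fun j => (r : ℂ) * Complex.exp ((t j : ℂ) * Complex.I))‖ₑ ^ p =
      ENNReal.ofReal (C * (polyPoisson b t • g t)) := by
    intro t
    have : (fun j => (r : ℂ) * Complex.exp ((t j : ℂ) * Complex.I)) =
        (r : ℂ) • torusMap 0 1 t := by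
      ext j; simp [torusMap]
    rw [this, smul_eq_mul, ← mul_assoc, ← hfg, ← ofReal_norm,
      ENNReal.ofReal_rpow_of_nonneg (norm_nonneg _) (by linarith)]
  have hnn : ∀ t : Fin n → ℝ, 0 ≤ C * (polyPoisson b t • g t) := fun t =>
    mul_nonneg hC (mul_nonneg (polyPoisson_nonneg hb t) (hg0 t))
  simp only [torusMean, hpt]
  rw [← ofReal_integral_eq_lintegral_ofReal ((integrableOn_polyPoisson_smul hb hg).const_mul C)
    (Filter.Eventually.of_forall hnn), ← ENNReal.ofReal_mul (by positivity),
    integral_const_mul, mul_left_comm, ENNReal.ofReal_rpow_of_nonneg]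
  · rfl
  · exact mul_nonneg hC (mul_nonneg (by positivity) (integral_nonneg fun t =>
      mul_nonneg (polyPoisson_nonneg hb t) (hg0 t)))
  · positivity

theorem poissonMean_nonneg {b : Fin n → ℂ} (hb : b ∈ polydisk n) {g : (Fin n → ℝ) → ℝ}
    (hg : ∀ t, 0 ≤ g t) : 0 ≤ poissonMean b g :=
  mul_nonneg (by positivity) (integral_nonneg fun t =>
    mul_nonneg (polyPoisson_nonneg hb t) (hg t))

theorem le_hardyNorm_rpow {p : ℝ} (hp : 1 < p) {f : (Fin n → ℂ) → ℂ} (hf : MemHardy p f)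
    {r : ℝ} (hr : r ∈ Set.Ioo (0 : ℝ) 1) {C : ℝ} {b : Fin n → ℂ}
    (hb : b ∈ polydisk n) (hC : 0 ≤ C) {g : (Fin n → ℝ) → ℝ} (hg : Continuous g)
    (hg0 : ∀ t, 0 ≤ g t)
    (hfg : ∀ t, ‖f ((r : ℂ) • torusMap 0 1 t)‖ ^ p = C * polyPoisson b t * g t) :
    C * poissonMean b g ≤ hardyNorm p f ^ p := by
  have h1 : torusMean p f r ≤ hardyENorm p f := le_iSup₂ (f := fun r _ => torusMean p f r) r hr
  rw [torusMean_eq hp hb hC hg hg0 hfg, ENNReal.ofReal_le_iff_le_toReal hf.2.ne] at h1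
  have h0 : 0 ≤ C * poissonMean b g := mul_nonneg hC (poissonMean_nonneg hb hg0)
  have h2 := Real.rpow_le_rpow (by positivity) h1 (by linarith : 0 ≤ p)
  rwa [← Real.rpow_mul h0, one_div_mul_cancel (by linarith), Real.rpow_one] at h2

end Mean

/-! ### Point evaluation, its extremal functions and uniqueness. -/

section Interpolation

variable {n : ℕ} {p : ℝ} {z₀ : Fin n → ℂ}

theorem one_sub_norm_sq_pos {b : Fin n → ℂ} (hb : b ∈ polydisk n) (j : Fin n) :
    0 < 1 - ‖b j‖ ^ 2 := by
  nlinarith [hb j, norm_nonneg (b j)]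

/-- Each mean is computed exactly, since the Poisson kernel at `r • z₀` has mean one; the remaining
factor `P` is largest in the limit `r → 1`. -/
theorem hardyENorm_hardyMinInterpolant_le (hp : 1 < p) (hz₀ : z₀ ∈ polydisk n) (w₀ : ℂ) :
    hardyENorm p (hardyMinInterpolant p z₀ w₀) ≤
      ENNReal.ofReal (‖w₀‖ * ∏ j, (1 - ‖z₀ j‖ ^ 2) ^ (1 / p)) := by
  refine iSup₂_le fun r hr => ?_
  have hsq : ∀ j, 0 < 1 - r ^ 2 * ‖z₀ j‖ ^ 2 := fun j => by
    have h1 := one_sub_norm_sq_pos hz₀ j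
    have h2 : r ^ 2 ≤ 1 := by nlinarith [hr.1, hr.2]
    nlinarith [sq_nonneg ‖z₀ j‖]
  have hrz : (r : ℂ) • z₀ ∈ polydisk n := fun j => by
    have h1 := hz₀ j
    simp only [Pi.smul_apply, smul_eq_mul, norm_mul, Complex.norm_real, Real.norm_eq_abs,
      abs_of_pos hr.1]
    nlinarith [hr.1, hr.2, norm_nonneg (z₀ j)]
  set P := ∏ j, (1 - ‖z₀ j‖ ^ 2) ^ 2 / (1 - r ^ 2 * ‖z₀ j‖ ^ 2) with hP
  have hP0 : 0 ≤ P := Finset.prod_nonneg fun j _ => div_nonneg (sq_nonneg _) (hsq j).le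
  have hPle : P ≤ ∏ j, (1 - ‖z₀ j‖ ^ 2) := by
    refine Finset.prod_le_prod (fun j _ => div_nonneg (sq_nonneg _) (hsq j).le) fun j _ => ?_
    rw [div_le_iff₀ (hsq j), sq]
    have h1 := one_sub_norm_sq_pos hz₀ j
    have h2 : r ^ 2 ≤ 1 := by nlinarith [hr.1, hr.2]
    refine mul_le_mul_of_nonneg_left ?_ h1.le
    nlinarith [sq_nonneg ‖z₀ j‖]
  rw [torusMean_eq (C := ‖w₀‖ ^ p * P) (g := fun _ => 1) hp hrz (by positivity) continuous_const
    (fun _ => zero_le_one), poissonMean_one hrz, mul_one]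
  · refine ENNReal.ofReal_le_ofReal ?_
    rw [Real.finsetProd_rpow _ _ fun j _ => (one_sub_norm_sq_pos hz₀ j).le,
      Real.mul_rpow (by positivity) hP0, ← Real.rpow_mul (norm_nonneg _),
      mul_one_div_cancel (by linarith), Real.rpow_one]
    gcongr
  · intro t
    change ‖w₀ * hardyKernel p z₀ ((r : ℂ) • torusMap 0 1 t)‖ ^ p = _
    rw [norm_mul, Real.mul_rpow (norm_nonneg _) (norm_nonneg _),
      norm_hardyKernel_rpow hp hz₀ hr.1.le hr.2.le]
    ring

theorem memHardy_hardyMinInterpolant (hp : 1 < p) (hz₀ : z₀ ∈ polydisk n) (w₀ : ℂ) :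
    MemHardy p (hardyMinInterpolant p z₀ w₀) :=
  ⟨(differentiableOn_hardyKernel p hz₀ fun _ hz j =>
    norm_mul_conj_lt_one (hz j).le (hz₀ j)).const_mul w₀,
    (hardyENorm_hardyMinInterpolant_le hp hz₀ w₀).trans_lt ENNReal.ofReal_lt_top⟩

/-- The basic estimate on the torus of radius `r`: if `f` has value `w₀` at `z₀`, then the distance
of `f` to the kernel based on radius `r` is controlled by the defect in norm. -/
theorem interpolation_gap_of_radius (hp : 1 < p) {c δ : ℝ} (hc0 : 0 ≤ c)
    (hc : ∀ w : ℂ, c * (‖w - 1‖ - δ) ≤ ‖w‖ ^ p - 1 - p * (w.re - 1))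
    {f : (Fin n → ℂ) → ℂ} (hf : MemHardy p f) (hf₀ : f z₀ ≠ 0) {z : Fin n → ℂ} {r : ℝ}
    (hr : r ∈ Set.Ioo (0 : ℝ) 1) (hz₀r : ∀ j, ‖z₀ j‖ < r ^ 2) (hzr : ∀ j, ‖z j‖ < r) :
    c * (‖f z / (f z₀ * hardyKernel p ((r : ℂ)⁻¹ • z₀) ((r : ℂ)⁻¹ • z)) - 1‖ /
        harnackConst ((r : ℂ)⁻¹ • z) ((r : ℂ)⁻¹ • z₀) - δ) ≤
      hardyNorm p f ^ p / (‖f z₀‖ ^ p * ∏ j, (1 - ‖((r : ℂ)⁻¹ • z₀) j‖ ^ 2)) - 1 := by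
  obtain ⟨hr0, hr1⟩ := hr
  have hrC : (r : ℂ) ≠ 0 := Complex.ofReal_ne_zero.2 hr0.ne'
  have hnorm : ∀ (x : Fin n → ℂ) j, ‖((r : ℂ)⁻¹ • x) j‖ = ‖x j‖ / r := fun x j => by
    simp [abs_of_pos hr0, div_eq_inv_mul]
  -- Rescaling turns the torus of radius `r` into the unit torus. The hypothesis with `r ^ 2` makes
  -- `‖b j‖ < r`, so the kernel at `b` is holomorphic and nonvanishing on the ball of radius `r⁻¹`.
  set b := (r : ℂ)⁻¹ • z₀ with hbdef
  set b' := (r : ℂ)⁻¹ • z with hbdef'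
  have hbr : ∀ j, ‖b j‖ < r := fun j => by
    rw [hnorm, div_lt_iff₀ hr0, ← sq]; exact hz₀r j
  have hb : b ∈ polydisk n := fun j => (hbr j).trans hr1
  have hb' : b' ∈ polydisk n := fun j => by rw [hnorm, div_lt_one hr0]; exact hzr j
  have hsb : (r : ℂ) • b = z₀ := smul_inv_smul₀ hrC z₀
  have hsb' : (r : ℂ) • b' = z := smul_inv_smul₀ hrC z
  have hR : 1 < r⁻¹ := (one_lt_inv₀ hr0).2 hr1
  have hball : ∀ x ∈ ball (0 : Fin n → ℂ) r⁻¹, ∀ j, ‖x j‖ < r⁻¹ := fun x hx j =>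
    (norm_le_pi_norm x j).trans_lt (by simpa using hx)
  have hslit : ∀ x ∈ ball (0 : Fin n → ℂ) r⁻¹, ∀ j, ‖x j * conj (b j)‖ < 1 := fun x hx j => by
    rw [norm_mul, RCLike.norm_conj]
    calc ‖x j‖ * ‖b j‖ ≤ r⁻¹ * ‖b j‖ := by gcongr; exact (hball x hx j).le
      _ < r⁻¹ * r := by gcongr; exact hbr j
      _ = 1 := inv_mul_cancel₀ hr0.ne'
  set u : (Fin n → ℂ) → ℂ := fun x => f ((r : ℂ) • x) * (f z₀ * hardyKernel p b x)⁻¹ with hu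
  have hden : ∀ x ∈ ball (0 : Fin n → ℂ) r⁻¹, f z₀ * hardyKernel p b x ≠ 0 := fun x hx =>
    mul_ne_zero hf₀ (hardyKernel_ne_zero p hb (hslit x hx))
  have hud : DifferentiableOn ℂ u (ball 0 r⁻¹) := by
    refine DifferentiableOn.mul (hf.1.comp (by fun_prop) fun x hx j => ?_)
      (((differentiableOn_hardyKernel p hb hslit).const_mul (f z₀)).inv hden)
    rw [Pi.smul_apply, smul_eq_mul, norm_mul, Complex.norm_real, Real.norm_of_nonneg hr0.le]
    calc r * ‖x j‖ < r * r⁻¹ := by gcongr; exact hball x hx j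
      _ = 1 := mul_inv_cancel₀ hr0.ne'
  have huc : Continuous fun t => u (torusMap 0 1 t) :=
    hud.continuousOn.comp_continuous (continuous_torusMap 0 1) (torusMap_zero_one_mem_ball hR)
  have hub : u b = 1 := by
    simp only [hu]
    rw [hardyKernel_self p hb, mul_one, hsb, mul_inv_cancel₀ hf₀]
  have hmean : poissonMean b (fun t => u (torusMap 0 1 t)) = 1 := by
    rw [poissonMean_eq hR hud hb, hub]
  have hupow : Continuous fun t => ‖u (torusMap 0 1 t)‖ ^ p :=
    huc.norm.rpow_const fun _ => Or.inr (by linarith)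
  have hprod : 0 < ∏ j, (1 - ‖b j‖ ^ 2) := Finset.prod_pos fun j _ => one_sub_norm_sq_pos hb j
  have hw : 0 < ‖f z₀‖ ^ p := Real.rpow_pos_of_pos (norm_pos_iff.2 hf₀) p
  have hupper : ‖f z₀‖ ^ p * (∏ j, (1 - ‖b j‖ ^ 2)) *
      poissonMean b (fun t => ‖u (torusMap 0 1 t)‖ ^ p) ≤ hardyNorm p f ^ p := by
    refine le_hardyNorm_rpow hp hf ⟨hr0, hr1⟩ hb (by positivity) hupow (fun t => by positivity)
      fun t => ?_
    have h1 := norm_hardyKernel_rpow hp hb zero_le_one le_rfl t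
    have h2 : ∏ j, (1 - ‖b j‖ ^ 2) ^ 2 / (1 - (1 : ℝ) ^ 2 * ‖b j‖ ^ 2) = ∏ j, (1 - ‖b j‖ ^ 2) := by
      refine Finset.prod_congr rfl fun j _ => ?_
      rw [one_pow, one_mul, sq, mul_self_div_self]
    rw [h2] at h1
    simp only [Complex.ofReal_one, one_smul] at h1
    have h3 : f ((r : ℂ) • torusMap 0 1 t) =
        f z₀ * hardyKernel p b (torusMap 0 1 t) * u (torusMap 0 1 t) := by
      have := hden _ (torusMap_zero_one_mem_ball hR t)
      simp only [hu]
      rw [mul_left_comm, mul_inv_cancel₀ this, mul_one]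
    rw [h3, norm_mul, norm_mul, Real.mul_rpow (by positivity) (by positivity),
      Real.mul_rpow (by positivity) (by positivity), h1]
    ring
  have hgap := mul_poissonMean_norm_sub_one_le hp hc hb huc hmean
  -- Poisson's formula for `u - 1` at `b'`, with Harnack to replace the mean at `b'` by the mean at
  -- `b`.
  have hpt : ‖u b' - 1‖ / harnackConst b' b ≤
      poissonMean b (fun t => ‖u (torusMap 0 1 t) - 1‖) := by
    rw [div_le_iff₀' (harnackConst_pos hb' hb)]
    rw [← poissonMean_eq hR (H := fun x => u x - 1) (hud.sub_const 1) hb']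
    exact (norm_poissonMean_le hb' _).trans (poissonMean_le_harnackConst_mul hb' hb
      (huc.sub continuous_const).norm fun t => norm_nonneg _)
  have hub' : u b' = f z / (f z₀ * hardyKernel p b b') := by
    simp only [hu]
    rw [hsb', div_eq_mul_inv]
  rw [hub'] at hpt
  rw [mul_comm, ← le_div_iff₀ (by positivity)] at hupper
  calc _ ≤ c * (poissonMean b (fun t => ‖u (torusMap 0 1 t) - 1‖) - δ) := by gcongr
    _ ≤ _ := hgap
    _ ≤ _ := by gcongr

/-- The distance of `f` to the extremal function through the same point is controlled by the defect
in norm. -/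
theorem interpolation_gap (hp : 1 < p) {c δ : ℝ} (hc0 : 0 ≤ c)
    (hc : ∀ w : ℂ, c * (‖w - 1‖ - δ) ≤ ‖w‖ ^ p - 1 - p * (w.re - 1))
    {f : (Fin n → ℂ) → ℂ} (hf : MemHardy p f) (hz₀ : z₀ ∈ polydisk n) (hf₀ : f z₀ ≠ 0)
    {z : Fin n → ℂ} (hz : z ∈ polydisk n) :
    c * (‖f z / (f z₀ * hardyKernel p z₀ z) - 1‖ / harnackConst z z₀ - δ) ≤
      hardyNorm p f ^ p / (‖f z₀‖ ^ p * ∏ j, (1 - ‖z₀ j‖ ^ 2)) - 1 := by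
  have hinv : ∀ x : Fin n → ℂ, ∀ j,
      ContinuousAt (fun r : ℝ => ((r : ℂ)⁻¹ • x) j) 1 := fun x j => by
    simp only [Pi.smul_apply, smul_eq_mul]
    refine ContinuousAt.mul (ContinuousAt.inv₀ Complex.continuous_ofReal.continuousAt ?_)
      continuousAt_const
    simp
  have hone : ∀ x : Fin n → ℂ, ((1 : ℝ) : ℂ)⁻¹ • x = x := fun x => by simp
  have hker : ContinuousAt (fun r : ℝ => hardyKernel p ((r : ℂ)⁻¹ • z₀) ((r : ℂ)⁻¹ • z)) 1 := by
    refine tendsto_finsetProd _ fun j _ => ?_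
    have hlt := norm_mul_conj_lt_one (hz j).le (hz₀ j)
    refine ContinuousAt.cpow (ContinuousAt.div ?_ ?_ ?_) continuousAt_const ?_
    · exact continuousAt_const.sub
        ((Complex.continuous_ofReal.continuousAt.comp (hinv z₀ j).norm).pow 2)
    · exact continuousAt_const.sub ((hinv z j).mul (Complex.continuous_conj.continuousAt.comp
        (hinv z₀ j)))
    · simp only [hone]
      exact one_sub_ne_zero_of_norm_lt_one hlt
    · simp only [hone]
      exact div_one_sub_mem_slitPlane (hz₀ j) (norm_nonneg _) hlt
  have hharn : ContinuousAt (fun r : ℝ => harnackConst ((r : ℂ)⁻¹ • z) ((r : ℂ)⁻¹ • z₀)) 1 := by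
    refine tendsto_finsetProd _ fun j _ => ?_
    refine ContinuousAt.mul (ContinuousAt.div (continuousAt_const.add (hinv z j).norm)
      (continuousAt_const.sub (hinv z j).norm) ?_) (ContinuousAt.div
      (continuousAt_const.add (hinv z₀ j).norm) (continuousAt_const.sub (hinv z₀ j).norm) ?_)
    · simp only [hone]; exact (sub_pos.2 (hz j)).ne'
    · simp only [hone]; exact (sub_pos.2 (hz₀ j)).ne'
  have hprod : ContinuousAt (fun r : ℝ => ∏ j, (1 - ‖((r : ℂ)⁻¹ • z₀) j‖ ^ 2)) 1 :=
    tendsto_finsetProd _ fun j _ => continuousAt_const.sub ((hinv z₀ j).norm.pow 2)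
  have hL : ContinuousAt (fun r : ℝ =>
      c * (‖f z / (f z₀ * hardyKernel p ((r : ℂ)⁻¹ • z₀) ((r : ℂ)⁻¹ • z)) - 1‖ /
        harnackConst ((r : ℂ)⁻¹ • z) ((r : ℂ)⁻¹ • z₀) - δ)) 1 := by
    refine continuousAt_const.mul (ContinuousAt.sub (ContinuousAt.div (ContinuousAt.norm
      (ContinuousAt.sub (ContinuousAt.div continuousAt_const (continuousAt_const.mul hker) ?_)
        continuousAt_const)) hharn ?_) continuousAt_const)
    · simp only [hone]
      exact mul_ne_zero hf₀ (hardyKernel_ne_zero p hz₀ fun j =>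
        norm_mul_conj_lt_one (hz j).le (hz₀ j))
    · simp only [hone]
      exact (harnackConst_pos hz hz₀).ne'
  have hRt : ContinuousAt (fun r : ℝ =>
      hardyNorm p f ^ p / (‖f z₀‖ ^ p * ∏ j, (1 - ‖((r : ℂ)⁻¹ • z₀) j‖ ^ 2)) - 1) 1 := by
    refine ContinuousAt.sub (ContinuousAt.div continuousAt_const (continuousAt_const.mul hprod) ?_)
      continuousAt_const
    simp only [hone]
    exact mul_ne_zero (Real.rpow_pos_of_pos (norm_pos_iff.2 hf₀) p).ne'
      (Finset.prod_pos fun j _ => one_sub_norm_sq_pos hz₀ j).ne'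
  have hev1 : ∀ᶠ r : ℝ in nhdsWithin 1 (Set.Iio 1), ∀ j, ‖z₀ j‖ < r ^ 2 := by
    refine nhdsWithin_le_nhds (Filter.eventually_all.2 fun j => ?_)
    exact ((continuous_pow 2).continuousAt (x := (1 : ℝ))).eventually_const_lt
      (by simpa using hz₀ j)
  have hev2 : ∀ᶠ r : ℝ in nhdsWithin 1 (Set.Iio 1), ∀ j, ‖z j‖ < r :=
    nhdsWithin_le_nhds (Filter.eventually_all.2 fun j => eventually_gt_nhds (hz j))
  have hev3 : ∀ᶠ r : ℝ in nhdsWithin 1 (Set.Iio 1), r ∈ Set.Ioo (0 : ℝ) 1 :=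
    Ioo_mem_nhdsLT zero_lt_one
  have hle := le_of_tendsto_of_tendsto (hL.tendsto.mono_left nhdsWithin_le_nhds)
    (hRt.tendsto.mono_left nhdsWithin_le_nhds) (b := nhdsWithin 1 (Set.Iio 1)) (by
      filter_upwards [hev1, hev2, hev3] with r h1 h2 h3
      exact interpolation_gap_of_radius hp hc0 hc hf hf₀ h3 h1 h2)
  simpa only [hone] using hle

/-- The point evaluation estimate on the Hardy space of the polydisk. -/
theorem norm_mul_prod_le_hardyNorm (hp : 1 < p) {f : (Fin n → ℂ) → ℂ} (hf : MemHardy p f)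
    (hz₀ : z₀ ∈ polydisk n) : ‖f z₀‖ * ∏ j, (1 - ‖z₀ j‖ ^ 2) ^ (1 / p) ≤ hardyNorm p f := by
  by_cases hf₀ : f z₀ = 0
  · simp [hf₀, hardyNorm]
  -- With `c = 0` only plain Jensen remains: the defect is nonnegative. The second point is
  -- irrelevant and is taken to be `z₀`.
  have hgap := interpolation_gap hp (c := 0) (δ := 0) le_rfl
    (fun w => by simpa using bernoulli_gap_nonneg hp w) hf hz₀ hf₀ hz₀
  have hprod : 0 < ∏ j, (1 - ‖z₀ j‖ ^ 2) := Finset.prod_pos fun j _ => one_sub_norm_sq_pos hz₀ j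
  have hw : 0 < ‖f z₀‖ := norm_pos_iff.2 hf₀
  have hp0 : 0 < p := by linarith
  rw [zero_mul, sub_nonneg, one_le_div (by positivity)] at hgap
  rw [Real.finsetProd_rpow _ _ fun j _ => (one_sub_norm_sq_pos hz₀ j).le]
  have h0 : 0 ≤ hardyNorm p f := ENNReal.toReal_nonneg
  refine (Real.rpow_le_rpow_iff (by positivity) h0 hp0).1 ?_
  rwa [Real.mul_rpow (by positivity) (by positivity), ← Real.rpow_mul hprod.le,
    one_div_mul_cancel hp0.ne', Real.rpow_one]

theorem hardyMinInterpolant_self (hz₀ : z₀ ∈ polydisk n) (w₀ : ℂ) :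
    hardyMinInterpolant p z₀ w₀ z₀ = w₀ := by
  change w₀ * hardyKernel p z₀ z₀ = w₀
  rw [hardyKernel_self p hz₀, mul_one]

theorem hardyNorm_hardyMinInterpolant (hp : 1 < p) (hz₀ : z₀ ∈ polydisk n) (w₀ : ℂ) :
    hardyNorm p (hardyMinInterpolant p z₀ w₀) = ‖w₀‖ * ∏ j, (1 - ‖z₀ j‖ ^ 2) ^ (1 / p) := by
  refine le_antisymm (ENNReal.toReal_le_of_le_ofReal ?_
    (hardyENorm_hardyMinInterpolant_le hp hz₀ w₀)) ?_
  · exact mul_nonneg (norm_nonneg _) (Finset.prod_nonneg fun j _ =>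
      Real.rpow_nonneg (one_sub_norm_sq_pos hz₀ j).le _)
  · have := norm_mul_prod_le_hardyNorm hp (memHardy_hardyMinInterpolant hp hz₀ w₀) hz₀
    rwa [hardyMinInterpolant_self hz₀] at this

/-- Equality in the point evaluation estimate holds only for the extremal functions. -/
theorem eqOn_hardyMinInterpolant (hp : 1 < p) {f : (Fin n → ℂ) → ℂ} (hf : MemHardy p f)
    (hz₀ : z₀ ∈ polydisk n)
    (hle : hardyNorm p f ≤ ‖f z₀‖ * ∏ j, (1 - ‖z₀ j‖ ^ 2) ^ (1 / p)) :
    Set.EqOn f (hardyMinInterpolant p z₀ (f z₀)) (polydisk n) := by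
  intro z hz
  change f z = f z₀ * hardyKernel p z₀ z
  by_cases hf₀ : f z₀ = 0
  · rw [hf₀, norm_zero, zero_mul] at hle
    -- The norm is zero here, so point evaluation at `z` gives `f z = 0`.
    have h1 := (norm_mul_prod_le_hardyNorm hp hf hz).trans hle
    have h2 : 0 < ∏ j, (1 - ‖z j‖ ^ 2) ^ (1 / p) := Finset.prod_pos fun j _ =>
      Real.rpow_pos_of_pos (one_sub_norm_sq_pos hz j) _
    rw [hf₀, zero_mul, ← norm_le_zero_iff]
    exact nonpos_of_mul_nonpos_left h1 h2
  have hp0 : 0 < p := by linarith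
  have hprod : 0 < ∏ j, (1 - ‖z₀ j‖ ^ 2) := Finset.prod_pos fun j _ => one_sub_norm_sq_pos hz₀ j
  have hw : 0 < ‖f z₀‖ := norm_pos_iff.2 hf₀
  have hdef : hardyNorm p f ^ p / (‖f z₀‖ ^ p * ∏ j, (1 - ‖z₀ j‖ ^ 2)) - 1 ≤ 0 := by
    rw [sub_nonpos, div_le_one (by positivity)]
    have h0 : 0 ≤ hardyNorm p f := ENNReal.toReal_nonneg
    have := Real.rpow_le_rpow h0 hle hp0.le
    rwa [Real.finsetProd_rpow _ _ fun j _ => (one_sub_norm_sq_pos hz₀ j).le,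
      Real.mul_rpow (by positivity) (by positivity), ← Real.rpow_mul hprod.le,
      one_div_mul_cancel hp0.ne', Real.rpow_one] at this
  have hC := harnackConst_pos hz hz₀
  have hsmall : ‖f z / (f z₀ * hardyKernel p z₀ z) - 1‖ / harnackConst z z₀ ≤ 0 := by
    -- The constant `c` depends on `δ`, but with nonpositive defect only its sign matters, so `δ`
    -- may tend to `0`.
    refine le_of_forall_pos_le_add fun δ hδ => ?_
    obtain ⟨c, hc0, hc⟩ := exists_bernoulli_gap_ge hp hδ
    have := nonpos_of_mul_nonpos_right
      ((interpolation_gap hp hc0.le hc hf hz₀ hf₀ hz).trans hdef) hc0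
    linarith
  rw [div_le_iff₀ hC, zero_mul, norm_le_zero_iff, sub_eq_zero, div_eq_one_iff_eq] at hsmall
  · exact hsmall
  · exact mul_ne_zero hf₀ (hardyKernel_ne_zero p hz₀ fun j =>
      norm_mul_conj_lt_one (hz j).le (hz₀ j))

end Interpolation

theorem theorem4p3 (n : ℕ) (p : ℝ) (hp : 1 < p) (z₀ : Fin n → ℂ) (hz₀ : z₀ ∈ polydisk n)
    (w₀ : ℂ) :
    IsMinNormInterpolant p z₀ w₀ (hardyMinInterpolant p z₀ w₀) ∧
    (∀ f : (Fin n → ℂ) → ℂ, IsMinNormInterpolant p z₀ w₀ f →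
      Set.EqOn f (hardyMinInterpolant p z₀ w₀) (polydisk n)) ∧
    hardyNorm p (hardyMinInterpolant p z₀ w₀) =
      ‖w₀‖ * ∏ j, (1 - ‖z₀ j‖ ^ 2) ^ (1 / p) := by
  have hmem := memHardy_hardyMinInterpolant hp hz₀ w₀
  have hself := hardyMinInterpolant_self (p := p) hz₀ w₀
  have hnorm := hardyNorm_hardyMinInterpolant hp hz₀ w₀
  refine ⟨⟨hmem, hself, fun g hg hg₀ => ?_⟩, fun f ⟨hf, hf₀, hmin⟩ => ?_, hnorm⟩
  · rw [hnorm, ← hg₀]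
    exact norm_mul_prod_le_hardyNorm hp hg hz₀
  · have hle := hmin _ hmem hself
    rw [hnorm, ← hf₀] at hle
    rw [← hf₀]
    exact eqOn_hardyMinInterpolant hp hf hz₀ hle
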